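/- Let $\mathcal X\subseteq\mathbb R^m$ be closed and convex, let $f:\mathcal X\to\mathbb R$ be convex with its minimum $f_\star=f(x_\star)$ attained at some $x_\star\in\mathcal X$, and let $\mathcal G$ be a stochastic gradient oracle: queried at $x\in\mathcal X$ it returns a fresh random vector $\mathcal G(x)\in\mathbb R^m$ (whose conditional law given the past depends only on $x$) with $\mathbb E[\mathcal G(x)]\in\partial f(x)$ and $\|\mathcal G(x)\|\le \ell(x)$ almost surely, where $\ell:\mathcal X\to\mathbb R$ is continuous. Given $x_0\in\mathcal X$ and $r_\epsilon>0$, the DoG iterates are $$x_{t+1}=\mathrm{Proj}_{\mathcal X}\Big(x_t-\frac{\bar r_t}{\sqrt{G_t}}\,g_t\Big),\quad g_t=\mathcal G(x_t),\quad \bar r_t=\max\Big\{\max_{k\le t}\|x_k-x_0\|,\,r_\epsilon\Big\},\quad G_t=\sum_{k=0}^t\|g_k\|^2$$ (with a zero step if $G_t=0$). Let $\bar x_t=\big(\sum_{k<t}\bar r_k\big)^{-1}\sum_{k<t}\bar r_k x_k$, $d_0=\|x_0-x_\star\|$, $\log_+ z=1+\log z$ and $\theta_{t,\delta}=\log\big(60\log(6t)/\delta\big)$.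 There are universal constants $C_1,C_2>0$ such that for all such data, every $D\ge d_0$, every $\delta\in(0,1)$ and every integer $T\ge 1$, with $L_D=\max\{\ell(x): x\in\mathcal X,\ \|x-x_0\|\le D\}$, the following holds with probability at least $1-\delta-\mathbb P(\bar r_T>D)$: every $\tau\in\arg\max_{t\le T}\sum_{i<t}\bar r_i/\bar r_t$ satisfies $$f(\bar x_\tau)-f_\star\;\le\; C_1\,\frac{D\sqrt{G_{\tau-1}\theta_{\tau,\delta}+L_D^2\theta_{\tau,\delta}^2}}{T}\,\log_+\!\Big(\frac{D}{r_\epsilon}\Big)\;\le\; C_2\,\frac{D L_D}{\sqrt T}\,\theta_{\tau,\delta}\,\log_+\!\Big(\frac{D}{r_\epsilon}\Big).$$ -/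

import Mathlib

open MeasureTheory ProbabilityTheory Filter

namespace DoG

noncomputable section

/-- Points and gradients live in `m`-dimensional Euclidean space. -/
abbrev Vec (m : ℕ) : Type := EuclideanSpace ℝ (Fin m)

/-- The logarithm convention `log₊ z = 1 + log z`. -/
def logPlus (z : ℝ) : ℝ := 1 + Real.log z

/-- `θ_{t,δ} = log (60 log (6 t) / δ)`. -/
def theta (t : ℕ) (δ : ℝ) : ℝ := Real.log (60 * Real.log (6 * (t : ℝ)) / δ)

/-- The subdifferential at `x` of a function `f` with domain `X`. -/
def subdiff {m : ℕ} (X : Set (Vec m)) (f : Vec m → ℝ) (x : Vec m) : Set (Vec m) :=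
  {v | ∀ y ∈ X, f x + inner ℝ v (y - x) ≤ f y}

/-- `p` is the Euclidean projection of `z` onto `X`: the point of `X` nearest to `z`
(it exists and is unique when `X` is nonempty, closed and convex). -/
def IsProj {m : ℕ} (X : Set (Vec m)) (z p : Vec m) : Prop :=
  p ∈ X ∧ ∀ y ∈ X, ‖z - p‖ ≤ ‖z - y‖

/-- Convexity: `X` is closed and convex, `f` is convex on `X`, and its minimum over `X` is attained
at the point `xstar` of `X`. -/
structure ConvexProblem {m : ℕ} (X : Set (Vec m)) (f : Vec m → ℝ) (xstar : Vec m) : Prop where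
  isClosed : IsClosed X
  convexOn : ConvexOn ℝ X f
  mem : xstar ∈ X
  isMinOn : IsMinOn f X xstar

/-- A stochastic gradient oracle for `f : X → ℝ`, given by the law `𝒢 x` of its answer at each
query point `x`: the mean of the answer is a subgradient of `f` at `x`, and its norm is almost
surely at most `ℓ x`, where `ℓ` is continuous on `X`. Only queries `x ∈ X` matter. -/
structure IsGradientOracle {m : ℕ} (X : Set (Vec m)) (f : Vec m → ℝ) (𝒢 : Kernel (Vec m) (Vec m))
    (ℓ : Vec m → ℝ) : Prop where
  mean_mem : ∀ x ∈ X, (∫ v, v ∂(𝒢 x)) ∈ subdiff X f x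
  continuousOn : ContinuousOn ℓ X
  norm_le : ∀ x ∈ X, ∀ᵐ v ∂(𝒢 x), ‖v‖ ≤ ℓ x

/-- `r̄_t = max (max_{k ≤ t} ‖x_k - x_0‖) rε`. -/
def rbar {m : ℕ} (rε : ℝ) (x : ℕ → Vec m) (t : ℕ) : ℝ :=
  max ((Finset.range (t + 1)).sup' Finset.nonempty_range_add_one fun k => ‖x k - x 0‖) rε

/-- `G_t = ∑_{k ≤ t} ‖g_k‖²`. -/
def gradSum {m : ℕ} (g : ℕ → Vec m) (t : ℕ) : ℝ :=
  ∑ k ∈ Finset.range (t + 1), ‖g k‖ ^ 2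

/-- The step size `η_t = r̄_t / √G_t`. If `G_t = 0` then `g_t = 0`, and the value given to `η_t`
does not matter for the step `η_t g_t = 0`. -/
def stepSize {m : ℕ} (rε : ℝ) (x g : ℕ → Vec m) (t : ℕ) : ℝ :=
  rbar rε x t / √(gradSum g t)

/-- The weighted average `x̄_t = (∑_{k < t} r̄_k x_k) / ∑_{k < t} r̄_k`. -/
def xbar {m : ℕ} (rε : ℝ) (x : ℕ → Vec m) (t : ℕ) : Vec m :=
  (∑ k ∈ Finset.range t, rbar rε x k)⁻¹ • ∑ k ∈ Finset.range t, rbar rε x k • x k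

/-- `∑_{i < t} r̄_i / r̄_t`. -/
def ratioSum {m : ℕ} (rε : ℝ) (x : ℕ → Vec m) (t : ℕ) : ℝ :=
  ∑ i ∈ Finset.range t, rbar rε x i / rbar rε x t

/-- `τ` belongs to `argmax_{t ≤ T} ∑_{i < t} r̄_i / r̄_t`. -/
def IsBestTime {m : ℕ} (rε : ℝ) (x : ℕ → Vec m) (T τ : ℕ) : Prop :=
  τ ≤ T ∧ ∀ t ≤ T, ratioSum rε x t ≤ ratioSum rε x τ

/-- A run of projected SGD with the DoG step sizes, started at `x₀`, on a probability space with a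
filtration `ℱ`, where `ℱ t` is the information available before the oracle's answer to query number
`t`. The answer `g t` becomes known at time `t + 1`, and its conditional law given `ℱ t` is
`𝒢 (x t)`, i.e. `P(A ∩ {g t ∈ S}) = ∫_A 𝒢(x t)(S) dP` for every event `A` of `ℱ t`. -/
structure IsDoGRun {m : ℕ} {Ω : Type*} [mΩ : MeasurableSpace Ω] (P : Measure Ω)
    (ℱ : Filtration ℕ mΩ) (X : Set (Vec m)) (𝒢 : Kernel (Vec m) (Vec m)) (x₀ : Vec m) (rε : ℝ)
    (x g : ℕ → Ω → Vec m) : Prop where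
  init : ∀ ω, x 0 ω = x₀
  step : ∀ t ω, IsProj X
    (x t ω - stepSize rε (fun k => x k ω) (fun k => g k ω) t • g t ω) (x (t + 1) ω)
  measurable_answer : ∀ t, Measurable[ℱ (t + 1)] (g t)
  law_answer : ∀ t, ∀ A, MeasurableSet[ℱ t] A → ∀ S, MeasurableSet S →
    P (A ∩ g t ⁻¹' S) = ∫⁻ ω in A, 𝒢 (x t ω) S ∂P

/-- `L_D = max {ℓ x : x ∈ X, ‖x - x₀‖ ≤ D}`. -/
def localBound {m : ℕ} (X : Set (Vec m)) (ℓ : Vec m → ℝ) (x₀ : Vec m) (D : ℝ) : ℝ :=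
  sSup (ℓ '' {x ∈ X | ‖x - x₀‖ ≤ D})

/-- The supremum in `localBound` is a maximum. -/
theorem isGreatest_localBound {m : ℕ} {X : Set (Vec m)} {ℓ : Vec m → ℝ} {x₀ : Vec m} {D : ℝ}
    (hX : IsClosed X) (hℓ : ContinuousOn ℓ X) (hx₀ : x₀ ∈ X) (hD : 0 ≤ D) :
    IsGreatest (ℓ '' {x ∈ X | ‖x - x₀‖ ≤ D}) (localBound X ℓ x₀ D) := by
  have hset : {x ∈ X | ‖x - x₀‖ ≤ D} = Metric.closedBall x₀ D ∩ X := by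
    ext y
    simp [dist_eq_norm, and_comm]
  have hK : IsCompact {x ∈ X | ‖x - x₀‖ ≤ D} := by
    rw [hset]
    exact (isCompact_closedBall x₀ D).inter_right hX
  exact (hK.image_of_continuousOn (hℓ.mono fun _ h => h.1)).isGreatest_sSup
    ⟨ℓ x₀, x₀, ⟨hx₀, by simpa using hD⟩, rfl⟩

end

end DoG

/-! Weight iterate `k` by `r̄_k`. By Jensen and the subgradient inequality, `(∑ r̄_k) (f(x̄_τ) -
f_⋆)` is at most the weighted regret `∑ r̄_k ⟨g_k, x_k - x_⋆⟩` minus the weighted noise.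

Regret: since `η_k √G_k = r̄_k`, one projected step bounds `r̄_k ⟨g_k, x_k - x_⋆⟩` by a difference
of squared distances weighted by `√G_k / 2`, plus `r̄_k² ‖g_k‖² / (2 √G_k)`. Summation by parts
against the monotone `√G_k` gives `O(D r̄_τ √G_{τ-1})` (`sum_rbar_mul_inner_le`).

Noise: the weights `r̄_k` are monotone too, so the same summation by parts leaves `r̄_τ` times a
uniform bound on unweighted partial sums. These form a martingale, controlled by an exponential
supermartingale, Ville's inequality and a union over geometric scales
(`IsDoGRun.measureReal_exists_noise_gt_le`). The compensator uses uncentred squares, hence is at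
most `(2D)² G`, and the union over scales costs only an iterated logarithm.

Both terms carry the factor `r̄_τ`, so what remains is division by `∑_{k<τ} r̄_k / r̄_τ`. A monotone
sequence for which all such ratios are small grows exponentially, while `r̄` only grows from `r_ε`
to at most `D`; so the best ratio is at least `T / (6 log₊(D / r_ε))`. -/

namespace DoG

/-! ### Euclidean projections -/

section Projection

variable {m : ℕ} {X : Set (Vec m)} {z z' p p' : Vec m}

theorem IsProj.inner_le (hX : Convex ℝ X) (h : IsProj X z p) {y : Vec m} (hy : y ∈ X) :
    inner ℝ (z - p) (y - p) ≤ 0 := by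
  have : Nonempty X := ⟨⟨p, h.1⟩⟩
  refine (norm_eq_iInf_iff_real_inner_le_zero hX h.1).1 (le_antisymm ?_ ?_) y hy
  · exact le_ciInf fun w => h.2 w w.2
  · exact ciInf_le (f := fun w : X => ‖z - w‖) ⟨0, by rintro _ ⟨w, rfl⟩; positivity⟩ ⟨p, h.1⟩

/-- Adding the two variational inequalities gives firm nonexpansiveness; Cauchy–Schwarz does the
rest. -/
theorem IsProj.norm_sub_le (hX : Convex ℝ X) (h : IsProj X z p) (h' : IsProj X z' p') :
    ‖p - p'‖ ≤ ‖z - z'‖ := by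
  have h₁ := h.inner_le hX h'.1
  have h₂ := h'.inner_le hX h.1
  have h₃ : ‖p - p'‖ ^ 2 ≤ inner ℝ (z - z') (p - p') := by
    rw [← real_inner_self_eq_norm_sq]
    have e : inner ℝ (z - z') (p - p') = inner ℝ (p - p') (p - p')
        - inner ℝ (z - p) (p' - p) - inner ℝ (z' - p') (p - p') := by
      simp only [inner_sub_left, inner_sub_right]
      ring
    linarith
  have h₄ := real_inner_le_norm (z - z') (p - p')
  rcases (norm_nonneg (p - p')).eq_or_lt with h₅ | h₅
  · rw [← h₅]
    exact norm_nonneg _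
  · nlinarith

theorem isProj_self {y : Vec m} (hy : y ∈ X) : IsProj X y y :=
  ⟨hy, fun w _ => by simp⟩

theorem exists_isProj (hX : Convex ℝ X) (hc : IsClosed X) (hn : X.Nonempty) (z : Vec m) :
    ∃ p, IsProj X z p := by
  obtain ⟨p, hp, h⟩ := exists_norm_eq_iInf_of_complete_convex hn hc.isComplete hX z
  refine ⟨p, hp, fun y hy => ?_⟩
  rw [h]
  exact ciInf_le (f := fun w : X => ‖z - w‖) ⟨0, by rintro _ ⟨w, rfl⟩; positivity⟩ ⟨y, hy⟩

/-- The projection onto a nonempty closed convex set is a continuous map. -/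
theorem exists_continuous_isProj (hX : Convex ℝ X) (hc : IsClosed X) (hn : X.Nonempty) :
    ∃ π : Vec m → Vec m, Continuous π ∧ ∀ z p, IsProj X z p → p = π z := by
  choose π hπ using exists_isProj hX hc hn
  refine ⟨π, ?_, fun z p h => ?_⟩
  · exact (LipschitzWith.of_dist_le_mul (K := 1) fun a b => by
      simpa [dist_eq_norm] using (hπ a).norm_sub_le hX (hπ b)).continuous
  · have := h.norm_sub_le hX (hπ z)
    rw [sub_self, norm_zero, norm_le_zero_iff, sub_eq_zero] at this
    exact this

end Projection

/-! ### The quantities `r̄_t` and `G_t` -/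

section Basic

variable {m : ℕ} {rε : ℝ} {x g : ℕ → Vec m} {k t : ℕ}

theorem norm_sub_le_rbar (h : k ≤ t) : ‖x k - x 0‖ ≤ rbar rε x t :=
  le_max_of_le_left (Finset.le_sup' (fun k => ‖x k - x 0‖) (Finset.mem_range.2 (by omega)))

theorem le_rbar : rε ≤ rbar rε x t := le_max_right _ _

theorem rbar_le {c : ℝ} (hc : rε ≤ c) (h : ∀ k ≤ t, ‖x k - x 0‖ ≤ c) : rbar rε x t ≤ c :=
  max_le (Finset.sup'_le _ _ fun k hk => h k (by simpa [Nat.lt_succ_iff] using hk)) hc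

theorem rbar_mono : Monotone (rbar rε x) := fun _ _ h =>
  rbar_le le_rbar fun _ hk => norm_sub_le_rbar (hk.trans h)

theorem rbar_pos (h : 0 < rε) : 0 < rbar rε x t := h.trans_le le_rbar

theorem rbar_zero (h : 0 < rε) : rbar rε x 0 = rε :=
  le_antisymm (rbar_le le_rfl fun k hk => by simp [Nat.le_zero.1 hk, h.le]) le_rbar

theorem gradSum_mono : Monotone (gradSum g) := fun _ _ h =>
  Finset.sum_le_sum_of_subset_of_nonneg (by simpa using h) fun _ _ _ => by positivity

theorem gradSum_nonneg : 0 ≤ gradSum g t := Finset.sum_nonneg fun _ _ => by positivity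

theorem gradSum_succ : gradSum g (t + 1) = gradSum g t + ‖g (t + 1)‖ ^ 2 :=
  Finset.sum_range_succ _ _

theorem sq_norm_le_gradSum : ‖g t‖ ^ 2 ≤ gradSum g t :=
  Finset.single_le_sum (f := fun k => ‖g k‖ ^ 2) (fun _ _ => by positivity)
    (Finset.self_mem_range_succ t)

theorem norm_stepSize_smul_le (h : 0 < rε) : ‖stepSize rε x g t • g t‖ ≤ rbar rε x t := by
  have hr := rbar_pos (x := x) (t := t) h
  rw [norm_smul, stepSize, Real.norm_of_nonneg (by positivity), div_mul_eq_mul_div]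
  refine div_le_of_le_mul₀ (by positivity) hr.le ?_
  gcongr
  exact Real.le_sqrt_of_sq_le sq_norm_le_gradSum

theorem norm_sub_le_two_mul_rbar (hk : k ≤ t) : ‖x k - x t‖ ≤ 2 * rbar rε x t := by
  have h₁ : ‖x k - x 0‖ ≤ rbar rε x t := norm_sub_le_rbar hk
  have h₂ : ‖x t - x 0‖ ≤ rbar rε x t := norm_sub_le_rbar le_rfl
  have h₃ := norm_sub_le (x k - x 0) (x t - x 0)
  rw [sub_sub_sub_cancel_right] at h₃
  linarith

/-- Each term is at most `2 (√G_k - √G_{k-1})`, with `G_{-1} = 0`, and these telescope. -/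
theorem sum_sq_norm_div_sqrt_gradSum_le (t : ℕ) :
    ∑ k ∈ Finset.range (t + 1), ‖g k‖ ^ 2 / √(gradSum g k) ≤ 2 * √(gradSum g t) := by
  have key : ∀ a b : ℝ, 0 ≤ a → a ≤ b → (b - a) / √b ≤ 2 * (√b - √a) := by
    intro a b ha hab
    refine div_le_of_le_mul₀ (Real.sqrt_nonneg _) ?_ ?_
    · linarith [Real.sqrt_le_sqrt hab]
    · have h₁ := Real.sq_sqrt ha
      have h₂ := Real.sq_sqrt (ha.trans hab)
      nlinarith [sq_nonneg (√b - √a)]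
  induction t with
  | zero =>
    have := key 0 (gradSum g 0) le_rfl gradSum_nonneg
    simpa [gradSum] using this
  | succ t ih =>
    rw [Finset.sum_range_succ]
    have := key (gradSum g t) (gradSum g (t + 1)) gradSum_nonneg (gradSum_mono t.le_succ)
    rw [gradSum_succ, add_sub_cancel_left, ← gradSum_succ] at this
    linarith

end Basic

/-- Summation by parts against nonnegative nondecreasing weights. -/
theorem sum_mul_sub_succ_le {a e : ℕ → ℝ} {E : ℝ} (ha : Monotone a) (ha₀ : 0 ≤ a 0) (t : ℕ)
    (he : ∀ k ≤ t, e k ≤ E) :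
    ∑ k ∈ Finset.range (t + 1), a k * (e k - e (k + 1)) ≤ a t * (E - e (t + 1)) := by
  induction t with
  | zero =>
    have := he 0 le_rfl
    simp only [zero_add, Finset.sum_range_one]
    gcongr
  | succ t ih =>
    rw [Finset.sum_range_succ]
    have h₁ := ih fun k hk => he k (hk.trans t.le_succ)
    have h₂ : a t * (E - e (t + 1)) ≤ a (t + 1) * (E - e (t + 1)) := by
      have := he (t + 1) le_rfl
      gcongr
      exact ha t.le_succ
    linarith

/-- A positive sequence whose partial sums stay below `M` times the current term grows
exponentially. -/
theorem le_mul_one_add_log_of_sum_div_le {s : ℕ → ℝ} {M : ℝ} {T : ℕ} (hs : Monotone s)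
    (hpos : ∀ t, 0 < s t) (h3 : s 1 ≤ 3 * s 0) (hT : 1 ≤ T)
    (hM : ∀ t ≤ T, ∑ i ∈ Finset.range t, s i / s t ≤ M) :
    (T : ℝ) ≤ 6 * M * (1 + Real.log (s T / s 0)) := by
  -- This absorbs the rounding in `k`: `k < e M + 1 ≤ 3 M + 3 M`.
  have hM₃ : 1 / 3 ≤ M := by
    refine le_trans ?_ (hM 1 hT)
    rw [Finset.sum_range_one, div_le_div_iff₀ (by norm_num) (hpos 1)]
    linarith
  set k := ⌈Real.exp 1 * M⌉₊ with hk
  have hkM : Real.exp 1 * M ≤ k := Nat.le_ceil _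
  have hkM' : (k : ℝ) < Real.exp 1 * M + 1 := Nat.ceil_lt_add_one (by positivity)
  have hk0 : 0 < k := Nat.ceil_pos.2 (by positivity)
  -- A window of `k ≥ e M` terms, each at least `s t`, contributes at most `M s (t + k)`, so `s`
  -- gains a factor `e`.
  have step : ∀ t, t + k ≤ T → Real.exp 1 * s t ≤ s (t + k) := by
    intro t ht
    have h₁ : (k : ℝ) * (s t / s (t + k)) ≤ M := by
      refine le_trans ?_ (hM (t + k) ht)
      calc (k : ℝ) * (s t / s (t + k))
          = ∑ i ∈ Finset.Ico t (t + k), s t / s (t + k) := by simp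
        _ ≤ ∑ i ∈ Finset.Ico t (t + k), s i / s (t + k) := by
            refine Finset.sum_le_sum fun i hi => ?_
            have := (hpos (t + k)).le
            gcongr
            exact hs (Finset.mem_Ico.1 hi).1
        _ ≤ _ := by
            refine Finset.sum_le_sum_of_subset_of_nonneg ?_ fun i _ _ =>
              div_nonneg (hpos _).le (hpos _).le
            intro i hi
            simp only [Finset.mem_Ico, Finset.mem_range] at hi ⊢
            omega
    have h₂ : Real.exp 1 * M * (s t / s (t + k)) ≤ M :=
      (mul_le_mul_of_nonneg_right hkM (div_nonneg (hpos _).le (hpos _).le)).trans h₁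
    have h₃ : Real.exp 1 * (s t / s (t + k)) ≤ 1 := by
      have : M * (Real.exp 1 * (s t / s (t + k))) ≤ M * 1 := by linarith
      exact le_of_mul_le_mul_left this (by positivity)
    rwa [← mul_div_assoc, div_le_one (hpos _)] at h₃
  have iter : ∀ j : ℕ, j * k ≤ T → Real.exp j * s 0 ≤ s (j * k) := by
    intro j
    induction j with
    | zero => simp
    | succ j ih =>
      intro hj
      rw [add_mul, one_mul] at hj ⊢
      have h₁ := ih (by omega)
      have h₂ := step _ hj
      refine le_trans ?_ h₂
      push_cast
      rw [Real.exp_add, mul_comm (Real.exp (j : ℝ)), mul_assoc]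
      gcongr
  have hj := (iter (T / k) (Nat.div_mul_le_self T k)).trans (hs (Nat.div_mul_le_self T k))
  have hlog : ((T / k : ℕ) : ℝ) ≤ Real.log (s T / s 0) := by
    rw [Real.le_log_iff_exp_le (div_pos (hpos _) (hpos _)), le_div_iff₀ (hpos 0)]
    exact hj
  have hTk : (T : ℝ) ≤ k * (1 + ((T / k : ℕ) : ℝ)) := by
    have := (Nat.lt_mul_div_succ T hk0).le
    rw [add_comm (1 : ℝ)]
    exact_mod_cast this
  have he : Real.exp 1 < 3 := Real.exp_one_lt_d9.trans (by norm_num)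
  calc (T : ℝ) ≤ k * (1 + ((T / k : ℕ) : ℝ)) := hTk
    _ ≤ 6 * M * (1 + Real.log (s T / s 0)) := by
      gcongr
      nlinarith

/-! ### Deterministic analysis of a run -/

section Run

variable {m : ℕ} {X : Set (Vec m)} {f : Vec m → ℝ} {xstar : Vec m} {rε D : ℝ} {x g : ℕ → Vec m}

/-- The first step has length at most `r̄_0`, and projecting onto a set containing `x 0` at most
doubles it. This keeps the best ratio away from zero. -/
theorem rbar_one_le (hrε : 0 < rε) (hx0 : x 0 ∈ X)
    (hstep : IsProj X (x 0 - stepSize rε x g 0 • g 0) (x 1)) :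
    rbar rε x 1 ≤ 3 * rbar rε x 0 := by
  have h := norm_stepSize_smul_le (x := x) (g := g) (t := 0) hrε
  have hp := rbar_pos (x := x) (t := 0) hrε
  refine rbar_le (by linarith [le_rbar (rε := rε) (x := x) (t := 0)]) fun k hk => ?_
  interval_cases k
  · rw [sub_self, norm_zero]
    positivity
  · have h₁ := hstep.2 _ hx0
    rw [sub_sub_cancel_left, norm_neg] at h₁
    have h₂ := norm_add_le (x 0 - stepSize rε x g 0 • g 0 - x 1) (stepSize rε x g 0 • g 0)
    rw [show x 0 - stepSize rε x g 0 • g 0 - x 1 + stepSize rε x g 0 • g 0 = -(x 1 - x 0) by abel,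
      norm_neg] at h₂
    linarith

/-- Expand the square in `‖x (k + 1) - xstar‖ ≤ ‖x k - η g k - xstar‖` and multiply by `√G_k / 2`,
using `η √G_k = r̄_k`. If `G_k = 0`, then `g k = 0` and both sides vanish. -/
theorem rbar_mul_inner_le (hX : Convex ℝ X) (hstar : xstar ∈ X) (hrε : 0 < rε) {k : ℕ}
    (hstep : IsProj X (x k - stepSize rε x g k • g k) (x (k + 1))) :
    rbar rε x k * inner ℝ (g k) (x k - xstar) ≤
      √(gradSum g k) * (‖x k - xstar‖ ^ 2 - ‖x (k + 1) - xstar‖ ^ 2) / 2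
        + rbar rε x k ^ 2 * (‖g k‖ ^ 2 / √(gradSum g k)) / 2 := by
  rcases (gradSum_nonneg (g := g) (t := k)).eq_or_lt with hG | hG
  · have : ‖g k‖ ^ 2 ≤ 0 := hG ▸ sq_norm_le_gradSum
    have hg : g k = 0 := by
      rw [← norm_le_zero_iff]
      nlinarith [norm_nonneg (g k)]
    simp [← hG, hg]
  · have hs : 0 < √(gradSum g k) := Real.sqrt_pos.2 hG
    have hr := rbar_pos (x := x) (t := k) hrε
    have h₁ := hstep.norm_sub_le hX (isProj_self hstar)
    have h₂ : ‖x (k + 1) - xstar‖ ^ 2 ≤ ‖x k - xstar‖ ^ 2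
        - 2 * (stepSize rε x g k * inner ℝ (g k) (x k - xstar))
        + stepSize rε x g k ^ 2 * ‖g k‖ ^ 2 := by
      refine (pow_le_pow_left₀ (norm_nonneg _) h₁ 2).trans_eq ?_
      rw [sub_right_comm, norm_sub_sq_real, inner_smul_right, norm_smul, mul_pow, Real.norm_eq_abs,
        sq_abs, real_inner_comm]
    have h₃ := mul_le_mul_of_nonneg_left h₂ (by positivity : 0 ≤ √(gradSum g k) / 2)
    have e₁ : √(gradSum g k) / 2 * (2 * (stepSize rε x g k * inner ℝ (g k) (x k - xstar)))
        = rbar rε x k * inner ℝ (g k) (x k - xstar) := by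
      rw [stepSize]
      field_simp
    have e₂ : √(gradSum g k) / 2 * (stepSize rε x g k ^ 2 * ‖g k‖ ^ 2)
        = rbar rε x k ^ 2 * (‖g k‖ ^ 2 / √(gradSum g k)) / 2 := by
      rw [stepSize]
      field_simp
    linarith

/-- The weighted regret of the iterates. -/
theorem sum_rbar_mul_inner_le (hX : Convex ℝ X) (hstar : xstar ∈ X) (hrε : 0 < rε) {t : ℕ}
    (hstep : ∀ k, IsProj X (x k - stepSize rε x g k • g k) (x (k + 1)))
    (hD : rbar rε x (t + 1) ≤ D) (hd : ‖x 0 - xstar‖ ≤ D) :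
    ∑ k ∈ Finset.range (t + 1), rbar rε x k * inner ℝ (g k) (x k - xstar) ≤
      5 * D * rbar rε x (t + 1) * √(gradSum g t) := by
  have hr := rbar_pos (x := x) (t := t + 1) hrε
  have hdist : ∀ k ≤ t + 1, ‖x k - xstar‖ ≤ 2 * D := fun k hk => by
    have h₁ := (norm_sub_le_rbar (rε := rε) (x := x) hk).trans hD
    have h₂ := norm_sub_le_norm_sub_add_norm_sub (x k) (x 0) xstar
    linarith
  have h₁ : ∑ k ∈ Finset.range (t + 1),
      √(gradSum g k) * (‖x k - xstar‖ ^ 2 - ‖x (k + 1) - xstar‖ ^ 2) ≤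
        √(gradSum g t) * (8 * D * rbar rε x (t + 1)) := by
    have := sum_mul_sub_succ_le (a := fun k => √(gradSum g k)) (e := fun k => ‖x k - xstar‖ ^ 2)
      -- A difference of squares: the distances differ by at most `2 r̄_{t+1}` and sum to at most `4
      -- D`. Staying linear in `r̄_{t+1}` is what later allows division by it.
      (E := ‖x (t + 1) - xstar‖ ^ 2 + 8 * D * rbar rε x (t + 1))
      (fun _ _ h => Real.sqrt_le_sqrt (gradSum_mono h)) (Real.sqrt_nonneg _) t fun k hk => by
        have a₁ := hdist k (by omega)
        have a₂ := hdist (t + 1) le_rfl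
        have a₃ := norm_sub_le_two_mul_rbar (rε := rε) (x := x) (show k ≤ t + 1 by omega)
        have a₄ := norm_sub_le_norm_sub_add_norm_sub (x k) (x (t + 1)) xstar
        have a₅ : ‖x k - xstar‖ - ‖x (t + 1) - xstar‖ ≤ 2 * rbar rε x (t + 1) := by linarith
        nlinarith [norm_nonneg (x k - xstar), norm_nonneg (x (t + 1) - xstar)]
    simpa using this
  have h₂ : ∑ k ∈ Finset.range (t + 1), rbar rε x k ^ 2 * (‖g k‖ ^ 2 / √(gradSum g k)) ≤
      rbar rε x (t + 1) * D * (2 * √(gradSum g t)) := by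
    refine le_trans (Finset.sum_le_sum fun k hk => ?_)
      ((Finset.mul_sum _ _ _).symm.trans_le (mul_le_mul_of_nonneg_left
        (sum_sq_norm_div_sqrt_gradSum_le t) (mul_nonneg hr.le (hr.le.trans hD))))
    have hk' : rbar rε x k ≤ rbar rε x (t + 1) := rbar_mono (by simp at hk; omega)
    have hk0 := rbar_pos (x := x) (t := k) hrε
    refine mul_le_mul_of_nonneg_right ?_ (by positivity)
    nlinarith
  calc _ ≤ ∑ k ∈ Finset.range (t + 1),
        (√(gradSum g k) * (‖x k - xstar‖ ^ 2 - ‖x (k + 1) - xstar‖ ^ 2) / 2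
          + rbar rε x k ^ 2 * (‖g k‖ ^ 2 / √(gradSum g k)) / 2) :=
        Finset.sum_le_sum fun k _ => rbar_mul_inner_le hX hstar hrε (hstep k)
    _ = _ := by rw [Finset.sum_add_distrib, ← Finset.sum_div, ← Finset.sum_div]
    _ ≤ _ := by linarith

/-- Jensen with weights `r̄_k / W`, then the subgradient inequality at each iterate. -/
theorem sum_rbar_mul_sub_le (hX : ConvexOn ℝ X f) (hrε : 0 < rε) (hx : ∀ k, x k ∈ X) {t : ℕ}
    {n : ℕ → Vec m} (hn : ∀ k, n k ∈ subdiff X f (x k)) (hstar : xstar ∈ X) (ht : 0 < t) :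
    (∑ k ∈ Finset.range t, rbar rε x k) * (f (xbar rε x t) - f xstar) ≤
      ∑ k ∈ Finset.range t, rbar rε x k * inner ℝ (n k) (x k - xstar) := by
  set W := ∑ k ∈ Finset.range t, rbar rε x k with hW
  have hWpos : 0 < W := Finset.sum_pos (fun k _ => rbar_pos hrε) ⟨0, by simpa using ht⟩
  have h₁ : f (xbar rε x t) ≤ ∑ k ∈ Finset.range t, (W⁻¹ * rbar rε x k) * f (x k) := by
    have e : xbar rε x t = ∑ k ∈ Finset.range t, (W⁻¹ * rbar rε x k) • x k := by
      simp only [xbar, Finset.smul_sum, smul_smul, hW]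
    rw [e]
    refine hX.map_sum_le (fun k _ => ?_) ?_ fun k _ => hx k
    · have := rbar_pos (x := x) (t := k) hrε
      positivity
    · rw [← Finset.mul_sum, inv_mul_cancel₀ hWpos.ne']
  have h₂ : W * f (xbar rε x t) ≤ ∑ k ∈ Finset.range t, rbar rε x k * f (x k) := by
    refine (mul_le_mul_of_nonneg_left h₁ hWpos.le).trans_eq ?_
    rw [Finset.mul_sum]
    refine Finset.sum_congr rfl fun k _ => ?_
    rw [mul_assoc, mul_inv_cancel_left₀ hWpos.ne']
  rw [mul_sub, sub_le_iff_le_add]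
  refine h₂.trans ?_
  rw [hW, Finset.sum_mul, ← Finset.sum_add_distrib]
  refine Finset.sum_le_sum fun k _ => ?_
  have h₃ := hn k xstar hstar
  rw [← neg_sub (x k), inner_neg_right] at h₃
  have := rbar_pos (x := x) (t := k) hrε
  rw [← mul_add]
  exact mul_le_mul_of_nonneg_left (by linarith) this.le

end Run

/-! ### Martingale tools -/

/-- From `log (1 + y) ≥ y - y² / (1 - |y|)`. The right side is linear in `y`, so expectations pass
through without centring the square. -/
theorem exp_sub_two_mul_sq_le {y : ℝ} (hy : |y| ≤ 1 / 2) : Real.exp (y - 2 * y ^ 2) ≤ 1 + y := by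
  have h₀ := abs_le.1 hy
  have h := Real.abs_log_sub_add_sum_range_le (x := -y) (by rw [abs_neg]; linarith) 1
  simp only [Finset.sum_range_one, zero_add, pow_one, Nat.cast_zero, div_one, abs_neg,
    sub_neg_eq_add, Nat.reduceAdd, sq_abs] at h
  have h₂ : y ^ 2 / (1 - |y|) ≤ 2 * y ^ 2 := by
    rw [div_le_iff₀ (by linarith)]
    nlinarith [sq_nonneg y]
  have h₃ := (abs_le.1 h).1
  rw [← Real.le_log_iff_exp_le (by linarith)]
  linarith

/-- A supermartingale factor for a bounded random vector tested against a direction `u`, with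
uncentred second moments in the exponent. -/
theorem lintegral_exp_inner_le_one {m : ℕ} (ν : Measure (Vec m)) [IsProbabilityMeasure ν]
    {u : Vec m} {c b : ℝ} (hb : ∀ᵐ v ∂ν, ‖v‖ ≤ b) (hc : |c| * (b * ‖u‖) ≤ 1 / 2) :
    ∫⁻ v, ENNReal.ofReal (Real.exp (c * (inner ℝ v u - inner ℝ (∫ w, w ∂ν) u)
      - 2 * c ^ 2 * inner ℝ v u ^ 2)) ∂ν ≤ 1 := by
  have hint : Integrable (fun v : Vec m => v) ν :=
    Integrable.of_bound measurable_id.aestronglyMeasurable b hb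
  have hint' : Integrable (fun v : Vec m => c * inner ℝ v u) ν :=
    (hint.inner_const u).const_mul c
  set μ := inner ℝ (∫ w, w ∂ν) u with hμ
  have hmean : ∫ v, inner ℝ v u ∂ν = μ := by
    rw [hμ, real_inner_comm, ← integral_inner hint u]
    exact integral_congr_ae (ae_of_all _ fun v => real_inner_comm _ _)
  have hle : ∀ᵐ v ∂ν, Real.exp (c * (inner ℝ v u - μ) - 2 * c ^ 2 * inner ℝ v u ^ 2)
      ≤ (1 + c * inner ℝ v u) * Real.exp (-(c * μ)) := by
    filter_upwards [hb] with v hv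
    have hy : |c * inner ℝ v u| ≤ 1 / 2 := by
      rw [abs_mul]
      refine le_trans ?_ hc
      gcongr
      exact (abs_real_inner_le_norm v u).trans (by gcongr)
    have := mul_le_mul_of_nonneg_right (exp_sub_two_mul_sq_le hy) (Real.exp_pos (-(c * μ))).le
    refine le_trans (le_of_eq ?_) this
    rw [← Real.exp_add]
    congr 1
    ring
  have hnn : 0 ≤ᵐ[ν] fun v => (1 + c * inner ℝ v u) * Real.exp (-(c * μ)) := by
    filter_upwards [hle] with v hv using (Real.exp_pos _).le.trans hv
  calc _ ≤ ∫⁻ v, ENNReal.ofReal ((1 + c * inner ℝ v u) * Real.exp (-(c * μ))) ∂ν :=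
        lintegral_mono_ae (by filter_upwards [hle] with v hv using ENNReal.ofReal_le_ofReal hv)
    _ = ENNReal.ofReal (∫ v, (1 + c * inner ℝ v u) * Real.exp (-(c * μ)) ∂ν) :=
        (ofReal_integral_eq_lintegral_ofReal
          (((integrable_const 1).add hint').mul_const _) hnn).symm
    _ = ENNReal.ofReal ((1 + c * μ) * Real.exp (-(c * μ))) := by
        rw [integral_mul_const, integral_add (integrable_const 1) hint', integral_const_mul, hmean]
        simp
    _ ≤ 1 := by
        rw [← ENNReal.ofReal_one]
        refine ENNReal.ofReal_le_ofReal ?_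
        have := Real.add_one_le_exp (c * μ)
        rw [Real.exp_neg, ← div_eq_mul_inv, div_le_one (Real.exp_pos _)]
        linarith

/-- Ville's maximal inequality over a finite horizon, for a nonnegative supermartingale with
values in `[0, ∞]`. -/
theorem mul_measure_exists_le_of_supermartingale {Ω : Type*} {mΩ : MeasurableSpace Ω}
    {P : Measure Ω} {ℱ : Filtration ℕ mΩ} {M : ℕ → Ω → ENNReal}
    (hM : ∀ t, Measurable[ℱ t] (M t))
    (hsuper : ∀ t A, MeasurableSet[ℱ t] A → ∫⁻ ω in A, M (t + 1) ω ∂P ≤ ∫⁻ ω in A, M t ω ∂P)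
    (c : ENNReal) (T : ℕ) :
    c * P {ω | ∃ t < T, c ≤ M t ω} ≤ ∫⁻ ω, M 0 ω ∂P := by
  have hmeas : ∀ T, MeasurableSet[ℱ T] {ω | ∃ t < T, c ≤ M t ω} := by
    intro T
    have : {ω | ∃ t < T, c ≤ M t ω} = ⋃ t ∈ Finset.range T, {ω | c ≤ M t ω} := by
      ext ω
      simp
    rw [this]
    refine Finset.measurableSet_biUnion _ fun t ht => ?_
    exact ℱ.mono (Finset.mem_range.1 ht).le _ (measurableSet_le measurable_const (hM t))
  -- The induction needs a stronger claim, which also keeps the mass of `M T` on paths that have not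
  -- yet crossed `c`.
  suffices h : ∀ T, c * P {ω | ∃ t < T, c ≤ M t ω}
      + ∫⁻ ω in {ω | ∃ t < T, c ≤ M t ω}ᶜ, M T ω ∂P ≤ ∫⁻ ω, M 0 ω ∂P from
    le_self_add.trans (h T)
  intro T
  induction T with
  | zero => simp
  | succ T ih =>
    refine le_trans ?_ ih
    set A := {ω | ∃ t < T, c ≤ M t ω} with hA
    set B := {ω | c ≤ M T ω} with hB
    have hAm := hmeas T
    have hBm : MeasurableSet[ℱ T] B := measurableSet_le measurable_const (hM T)
    have hAB : {ω | ∃ t < T + 1, c ≤ M t ω} = A ∪ Aᶜ ∩ B := by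
      ext ω
      simp only [hA, hB, Set.mem_ofPred_eq, Set.mem_union, Set.mem_inter_iff, Set.mem_compl_iff,
        Nat.lt_succ_iff_lt_or_eq, or_and_right, exists_or, exists_eq_left]
      by_cases h : ∃ t < T, c ≤ M t ω <;> simp [h]
    have hABc : (A ∪ Aᶜ ∩ B)ᶜ = Aᶜ \ B := by
      ext ω
      simp only [Set.mem_union, Set.mem_inter_iff, Set.mem_compl_iff, Set.mem_sdiff]
      tauto
    rw [hAB, hABc]
    have h₁ : c * P (Aᶜ ∩ B) ≤ ∫⁻ ω in Aᶜ ∩ B, M T ω ∂P := by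
      rw [← setLIntegral_const]
      exact setLIntegral_mono ((hM T).mono (ℱ.le T) le_rfl) fun ω hω => hω.2
    have h₂ : ∫⁻ ω in Aᶜ \ B, M (T + 1) ω ∂P ≤ ∫⁻ ω in Aᶜ \ B, M T ω ∂P :=
      hsuper T _ (hAm.compl.diff hBm)
    calc _ ≤ c * (P A + P (Aᶜ ∩ B)) + ∫⁻ ω in Aᶜ \ B, M (T + 1) ω ∂P := by
          gcongr
          exact measure_union_le _ _
      _ ≤ c * P A + (∫⁻ ω in Aᶜ ∩ B, M T ω ∂P + ∫⁻ ω in Aᶜ \ B, M T ω ∂P) := by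
          rw [mul_add, add_assoc]
          gcongr
      _ = c * P A + ∫⁻ ω in Aᶜ, M T ω ∂P := by
          rw [lintegral_inter_add_sdiff _ _ (ℱ.le T _ hBm)]

/-! ### Conditional laws along a run -/

section Law

variable {m : ℕ} {Ω : Type*} {mΩ : MeasurableSpace Ω} {P : Measure Ω} {ℱ : Filtration ℕ mΩ}
  {X : Set (Vec m)} {𝒢 : Kernel (Vec m) (Vec m)} {x₀ : Vec m} {rε : ℝ} {x g : ℕ → Ω → Vec m}

theorem IsDoGRun.mem (h : IsDoGRun P ℱ X 𝒢 x₀ rε x g) (hx₀ : x₀ ∈ X) (t : ℕ) (ω : Ω) :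
    x t ω ∈ X := by
  cases t with
  | zero => rwa [h.init]
  | succ t => exact (h.step t ω).1

theorem IsDoGRun.measurable (h : IsDoGRun P ℱ X 𝒢 x₀ rε x g) (hX : Convex ℝ X)
    (hc : IsClosed X) (hx₀ : x₀ ∈ X) (t : ℕ) : Measurable[ℱ t] (x t) := by
  obtain ⟨π, hπ, hproj⟩ := exists_continuous_isProj hX hc ⟨x₀, hx₀⟩
  induction t using Nat.strong_induction_on with
  | _ t ih =>
    cases t with
    | zero =>
      rw [show x 0 = fun _ => x₀ from funext h.init]
      exact measurable_const
    | succ t =>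
      have hxm : ∀ k ≤ t, Measurable[ℱ (t + 1)] (x k) := fun k hk =>
        (ih k (by omega)).mono (ℱ.mono (by omega)) le_rfl
      have hgm : ∀ k ≤ t, Measurable[ℱ (t + 1)] (g k) := fun k hk =>
        (h.measurable_answer k).mono (ℱ.mono (by omega)) le_rfl
      rw [show x (t + 1) = fun ω => π (x t ω
        - stepSize rε (fun k => x k ω) (fun k => g k ω) t • g t ω) from
        funext fun ω => hproj _ _ (h.step t ω)]
      refine hπ.measurable.comp ((hxm t le_rfl).sub (Measurable.fun_smul ?_ (hgm t le_rfl)))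
      refine Measurable.div (Measurable.max ?_ measurable_const) (Measurable.sqrt ?_)
      · have := @Finset.measurable_sup' ℝ _ Ω (ℱ (t + 1)) _ _ _ _
          (Finset.nonempty_range_add_one (n := t)) (fun k ω => ‖x k ω - x 0 ω‖) fun k hk =>
            measurable_norm.comp
              ((hxm k (by simpa [Nat.lt_succ_iff] using hk)).sub (hxm 0 (Nat.zero_le _)))
        convert this using 1
        ext ω
        simp
      · exact Finset.measurable_sum _ fun k hk =>
          (measurable_norm.comp (hgm k (by simpa [Nat.lt_succ_iff] using hk))).pow_const 2

/-- The law of the answer, applied to the event `‖x t - x₀‖ ≤ D` and the set `‖v‖ > L`, gives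
probability zero. -/
theorem IsDoGRun.ae_norm_answer_le (h : IsDoGRun P ℱ X 𝒢 x₀ rε x g) {t : ℕ}
    (hx : Measurable[ℱ t] (x t)) {D L : ℝ}
    (hL : ∀ ω, ‖x t ω - x₀‖ ≤ D → ∀ᵐ v ∂(𝒢 (x t ω)), ‖v‖ ≤ L) :
    ∀ᵐ ω ∂P, ‖x t ω - x₀‖ ≤ D → ‖g t ω‖ ≤ L := by
  have hA : MeasurableSet[ℱ t] {ω | ‖x t ω - x₀‖ ≤ D} :=
    (measurable_norm.comp (hx.sub_const x₀)) measurableSet_Iic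
  have hS : MeasurableSet {v : Vec m | ¬ ‖v‖ ≤ L} :=
    (measurableSet_le measurable_norm measurable_const).compl
  have := h.law_answer t _ hA _ hS
  rw [setLIntegral_congr_fun (g := fun _ => 0) (ℱ.le t _ hA) fun ω hω => ?_, lintegral_zero] at this
  · rw [ae_iff]
    refine measure_mono_null (fun ω hω => ?_) this
    exact Classical.not_imp.1 hω
  · exact ae_iff.1 (hL ω hω)

variable [IsProbabilityMeasure P] [IsMarkovKernel 𝒢]

/-- `law_answer` identifies the joint law with a composition product on rectangles, hence
everywhere. `W` carries whatever else of the past is needed. -/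
theorem IsDoGRun.lintegral_answer (h : IsDoGRun P ℱ X 𝒢 x₀ rε x g) {t : ℕ}
    (hx : Measurable[ℱ t] (x t)) {W : Ω → ENNReal} (hW : Measurable[ℱ t] W)
    {Φ : (Vec m × ENNReal) × Vec m → ENNReal} (hΦ : Measurable Φ) :
    ∫⁻ ω, Φ ((x t ω, W ω), g t ω) ∂P = ∫⁻ ω, ∫⁻ v, Φ ((x t ω, W ω), v) ∂(𝒢 (x t ω)) ∂P := by
  have hZ : Measurable[ℱ t] fun ω => (x t ω, W ω) := hx.prodMk hW
  have hZ' : Measurable fun ω => (x t ω, W ω) := hZ.mono (ℱ.le t) le_rfl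
  have hg : Measurable (g t) := (h.measurable_answer t).mono (ℱ.le _) le_rfl
  have hlaw : P.map (fun ω => ((x t ω, W ω), g t ω))
      = (P.map fun ω => (x t ω, W ω)) ⊗ₘ 𝒢.comap Prod.fst measurable_fst := by
    have : IsProbabilityMeasure (P.map (fun ω => ((x t ω, W ω), g t ω))) :=
      Measure.isProbabilityMeasure_map (hZ'.prodMk hg).aemeasurable
    have : IsProbabilityMeasure (P.map fun ω => (x t ω, W ω)) :=
      Measure.isProbabilityMeasure_map hZ'.aemeasurable
    refine Measure.ext_prod fun {s} {S} hs hS => ?_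
    rw [Measure.map_apply (hZ'.prodMk hg) (hs.prod hS), Measure.compProd_apply_prod hs hS,
      setLIntegral_map hs (Kernel.measurable_coe _ hS) hZ', Set.mk_preimage_prod]
    exact h.law_answer t _ (hZ hs) S hS
  have : IsProbabilityMeasure (P.map fun ω => (x t ω, W ω)) :=
    Measure.isProbabilityMeasure_map hZ'.aemeasurable
  rw [← lintegral_map hΦ (hZ'.prodMk hg), hlaw, Measure.lintegral_compProd hΦ,
    lintegral_map (Measurable.lintegral_kernel_prod_right' hΦ) hZ']
  rfl

theorem IsDoGRun.setLIntegral_mul_le (h : IsDoGRun P ℱ X 𝒢 x₀ rε x g) {t : ℕ}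
    (hx : Measurable[ℱ t] (x t)) {W : Ω → ENNReal} (hW : Measurable[ℱ t] W)
    {Φ : Vec m × Vec m → ENNReal} (hΦ : Measurable Φ)
    (hΦ₁ : ∀ ω, ∫⁻ v, Φ (x t ω, v) ∂(𝒢 (x t ω)) ≤ 1) {A : Set Ω} (hA : MeasurableSet[ℱ t] A) :
    ∫⁻ ω in A, W ω * Φ (x t ω, g t ω) ∂P ≤ ∫⁻ ω in A, W ω ∂P := by
  have key := h.lintegral_answer hx (W := A.indicator W)
    (hW.indicator hA)
    (Φ := fun z => z.1.2 * Φ (z.1.1, z.2)) (by fun_prop)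
  have hA' := ℱ.le t _ hA
  rw [← lintegral_indicator hA', ← lintegral_indicator hA']
  calc _ = ∫⁻ ω, A.indicator W ω * Φ (x t ω, g t ω) ∂P := by
        refine lintegral_congr fun ω => ?_
        by_cases hω : ω ∈ A <;> simp [hω]
    _ = ∫⁻ ω, ∫⁻ v, A.indicator W ω * Φ (x t ω, v) ∂(𝒢 (x t ω)) ∂P := key
    _ ≤ _ := by
        refine lintegral_mono fun ω => ?_
        rw [lintegral_const_mul _ (by fun_prop)]
        exact mul_le_of_le_one_right' (hΦ₁ ω)

end Law

/-! ### Time-uniform concentration -/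

theorem one_le_log_six_mul {t : ℕ} (ht : 1 ≤ t) : 1 + Real.log t ≤ Real.log (6 * t) := by
  have h₁ : (1 : ℝ) ≤ t := by exact_mod_cast ht
  have h₆ : 1 ≤ Real.log 6 := by
    rw [Real.le_log_iff_exp_le (by norm_num)]
    exact (Real.exp_one_lt_d9.trans (by norm_num)).le
  rw [Real.log_mul (by norm_num) (by positivity)]
  linarith

theorem one_le_theta {t : ℕ} {δ : ℝ} (ht : 1 ≤ t) (hδ : 0 < δ) (hδ₁ : δ < 1) : 1 ≤ theta t δ := by
  have h₁ := one_le_log_six_mul ht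
  have h₂ : 0 ≤ Real.log t := Real.log_natCast_nonneg t
  have h₃ : (60 : ℝ) ≤ 60 * Real.log (6 * t) / δ := by
    rw [le_div_iff₀ hδ]
    nlinarith
  rw [theta, Real.le_log_iff_exp_le (by linarith)]
  exact (Real.exp_one_lt_d9.trans (by norm_num)).le.trans h₃

theorem theta_mono {s t : ℕ} {δ : ℝ} (hs : 1 ≤ s) (hst : s ≤ t) (hδ : 0 < δ) :
    theta s δ ≤ theta t δ := by
  have h₁ := one_le_log_six_mul hs
  have h₂ : 0 ≤ Real.log s := Real.log_natCast_nonneg s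
  have h₃ : (1 : ℝ) ≤ s := by exact_mod_cast hs
  rw [theta, theta]
  have : Real.log (6 * s) ≤ Real.log (6 * t) := Real.log_le_log (by positivity) (by gcongr)
  refine Real.log_le_log (by have : 0 < Real.log (6 * s) := by linarith
                             positivity) (by gcongr)

/-- Tuning the exponential inequality over a geometric grid of scales. -/
theorem abs_le_of_forall_scale {S V B δ : ℝ} {t T : ℕ} (hB : 0 < B) (hδ : 0 < δ) (hδ₁ : δ < 1)
    (ht : 1 ≤ t) (htT : t ≤ T) (hV : 0 ≤ V) (hVt : V ≤ t * B ^ 2)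
    (h : ∀ i ≤ T, |S| ≤ 2 * (1 / (2 * B * 2 ^ i)) * V
      + Real.log (1 / (δ / (2 * ((i + 1) * (i + 2))))) / (1 / (2 * B * 2 ^ i))) :
    |S| ≤ 9 * √(theta t δ * V) + 5 * B * theta t δ := by
  set θ := theta t δ with hθdef
  have hθ : 1 ≤ θ := one_le_theta ht hδ hδ₁
  have hlog6 := one_le_log_six_mul ht
  have hlogt : 0 ≤ Real.log t := Real.log_natCast_nonneg t
  have htR : (1 : ℝ) ≤ t := by exact_mod_cast ht
  -- Here `i + 2 ≤ 3 log (6 t)`; the square of the logarithm and `δ² ≤ δ` turn into the factor `2`.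
  have hlogθ : ∀ i : ℕ, (i : ℝ) ≤ 1 + Real.log t →
      Real.log (1 / (δ / (2 * ((i + 1) * (i + 2))))) ≤ 2 * θ := by
    intro i hi
    rw [one_div_div, hθdef, theta, ← Nat.cast_two, ← Real.log_pow]
    refine Real.log_le_log (by positivity) ?_
    rw [div_pow, div_le_div_iff₀ hδ (by positivity)]
    have a₁ : ((i : ℝ) + 1) * (i + 2) ≤ 9 * Real.log (6 * t) ^ 2 := by
      have : (i : ℝ) + 2 ≤ 3 * Real.log (6 * t) := by linarith
      nlinarith [(Nat.cast_nonneg i : (0 : ℝ) ≤ i)]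
    have a₂ : δ ^ 2 ≤ δ := by nlinarith
    push_cast
    calc 2 * (((i : ℝ) + 1) * (i + 2)) * δ ^ 2
        ≤ 2 * (9 * Real.log (6 * t) ^ 2) * δ := by gcongr
      _ ≤ (60 * Real.log (6 * t)) ^ 2 * δ := by
        gcongr
        nlinarith [sq_nonneg (Real.log (6 * t))]
  have hex : ∃ i : ℕ, V ≤ 4 ^ i * (B ^ 2 * θ) := by
    obtain ⟨i, hi⟩ := pow_unbounded_of_one_lt (V / (B ^ 2 * θ)) (by norm_num : (1 : ℝ) < 4)
    refine ⟨i, ?_⟩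
    rw [div_lt_iff₀ (by positivity)] at hi
    exact hi.le
  classical
  -- The smallest adequate scale. For a positive index, minimality and `V ≤ t B²` force the
  -- preceding power of `4` below `t`, so the index is at most `1 + log t`.
  obtain ⟨i, hi, hmin⟩ : ∃ i : ℕ, V ≤ 4 ^ i * (B ^ 2 * θ) ∧
      ∀ j < i, ¬ V ≤ 4 ^ j * (B ^ 2 * θ) :=
    ⟨Nat.find hex, Nat.find_spec hex, fun j hj => Nat.find_min hex hj⟩
  have hsqrt : 0 ≤ √(θ * V) := Real.sqrt_nonneg _
  cases i with
  | zero =>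
    have h₀ := h 0 (Nat.zero_le _)
    have h₁ := hlogθ 0 (by simp; linarith)
    simp only [pow_zero, mul_one, one_mul] at h₀ hi
    -- Scale `0` costs `B θ + 4 B θ`, whence the `5`.
    have h₂ : 2 * (1 / (2 * B)) * V ≤ B * θ := by
      rw [show 2 * (1 / (2 * B)) * V = V / B by field_simp, div_le_iff₀ hB]
      linarith
    rw [div_div_eq_mul_div, div_one] at h₀
    nlinarith
  | succ i =>
    have hlt := not_le.1 (hmin i i.lt_succ_self)
    have hit : (4 : ℝ) ^ i < t := by
      have a₁ : 4 ^ i * (B ^ 2 * 1) ≤ 4 ^ i * (B ^ 2 * θ) := by gcongr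
      have a₂ : 4 ^ i * B ^ 2 < t * B ^ 2 := by linarith
      exact lt_of_mul_lt_mul_right a₂ (by positivity)
    have hilog : (i : ℝ) ≤ Real.log t := by
      rw [Real.le_log_iff_exp_le (by linarith)]
      refine le_trans ?_ hit.le
      rw [← Real.exp_one_pow]
      gcongr
      exact (Real.exp_one_lt_d9.trans (by norm_num)).le
    have hiT : i + 1 ≤ T := by
      have : (i : ℝ) < t := by
        refine hilog.trans_lt ?_
        linarith [Real.log_le_sub_one_of_pos (show (0 : ℝ) < t by linarith)]
      have : i < t := by exact_mod_cast this
      omega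
    have h₀ := h (i + 1) hiT
    have h₁ := hlogθ (i + 1) (by push_cast; linarith)
    set w := √(θ * V) with hw
    have hw2 : w ^ 2 = θ * V := Real.sq_sqrt (by positivity)
    have h4 : ∀ n : ℕ, (4 : ℝ) ^ n = (2 ^ n) ^ 2 := fun n => by
      rw [← pow_mul, mul_comm, pow_mul]
      norm_num
    set q : ℝ := 2 ^ i with hq
    have hqpos : 0 < q := by positivity
    rw [h4 (i + 1), pow_succ 2 i, ← hq] at hi
    rw [h4 i, ← hq] at hlt
    rw [pow_succ 2 i, ← hq, div_div_eq_mul_div, div_one] at h₀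
    have hV0 : 0 < V := lt_of_le_of_lt (by positivity) hlt
    have hlo : q * B * θ ≤ w := by
      refine Real.le_sqrt_of_sq_le ?_
      nlinarith
    have hup : V ≤ 2 * (q * B) * w := by
      have a₁ : V ^ 2 ≤ (2 * (q * B) * w) ^ 2 := by
        rw [mul_pow, hw2]
        nlinarith
      exact (pow_le_pow_iff_left₀ hV (by positivity) two_ne_zero).1 a₁
    -- The two terms cost `w` and `8 q B θ ≤ 8 w`, whence the `9`.
    have b₁ : 2 * (1 / (2 * B * (q * 2))) * V ≤ w := by
      rw [show 2 * (1 / (2 * B * (q * 2))) * V = V / (2 * (q * B)) by field_simp,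
        div_le_iff₀ (by positivity)]
      linarith
    have b₂ : Real.log (1 / (δ / (2 * ((((i + 1 : ℕ) : ℝ) + 1) * (((i + 1 : ℕ) : ℝ) + 2)))))
        * (2 * B * (q * 2)) ≤ 2 * θ * (2 * B * (q * 2)) := by gcongr
    nlinarith

section Concentration

/-- The centred oracle answers tested against the directions `u (x k)`, summed over `k < t`. -/
noncomputable def noiseSum {m : ℕ} (𝒢 : Kernel (Vec m) (Vec m)) (u : Vec m → Vec m) (x g : ℕ → Vec m)
    (t : ℕ) : ℝ :=
  ∑ k ∈ Finset.range t, (inner ℝ (g k) (u (x k)) - inner ℝ (∫ w, w ∂(𝒢 (x k))) (u (x k)))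

/-- The uncentred squares of the oracle answers tested against `u (x k)`, summed over `k < t`. -/
noncomputable def noiseVar {m : ℕ} (u : Vec m → Vec m) (x g : ℕ → Vec m) (t : ℕ) : ℝ :=
  ∑ k ∈ Finset.range t, inner ℝ (g k) (u (x k)) ^ 2

variable {m : ℕ} {Ω : Type*} {mΩ : MeasurableSpace Ω} {P : Measure Ω} {ℱ : Filtration ℕ mΩ}
  {X : Set (Vec m)} {𝒢 : Kernel (Vec m) (Vec m)} {x₀ : Vec m} {rε : ℝ} {x g : ℕ → Ω → Vec m}
  {u : Vec m → Vec m}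

theorem measurable_integral_kernel_id : Measurable fun y => ∫ w, w ∂(𝒢 y) :=
  (stronglyMeasurable_id.integral_kernel (κ := 𝒢)).measurable

variable [IsProbabilityMeasure P] [IsMarkovKernel 𝒢]

/-- Ville's inequality for the exponential of the compensated noise. The bound `b` may depend on the
query point: only its product with `‖u‖` must be uniform, so `u` may vanish where the oracle is
large. -/
theorem IsDoGRun.measureReal_exists_noise_ge_le (h : IsDoGRun P ℱ X 𝒢 x₀ rε x g)
    (hx : ∀ t, Measurable[ℱ t] (x t)) (hu : Measurable u) {c ε : ℝ} (hε : 0 < ε)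
    (hc : ∀ t ω, ∃ b, (∀ᵐ v ∂(𝒢 (x t ω)), ‖v‖ ≤ b) ∧ |c| * (b * ‖u (x t ω)‖) ≤ 1 / 2) (T : ℕ) :
    P.real {ω | ∃ t ≤ T, Real.log (1 / ε) ≤
      c * noiseSum 𝒢 u (fun k => x k ω) (fun k => g k ω) t
        - 2 * c ^ 2 * noiseVar u (fun k => x k ω) (fun k => g k ω) t} ≤ ε := by
  set Y : ℕ → Ω → ℝ := fun t ω => c * noiseSum 𝒢 u (fun k => x k ω) (fun k => g k ω) t
        - 2 * c ^ 2 * noiseVar u (fun k => x k ω) (fun k => g k ω) t with hY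
  set F : Vec m × Vec m → ℝ := fun z =>
    c * (inner ℝ z.2 (u z.1) - inner ℝ (∫ w, w ∂(𝒢 z.1)) (u z.1))
      - 2 * c ^ 2 * inner ℝ z.2 (u z.1) ^ 2 with hF
  have hmean := measurable_integral_kernel_id (𝒢 := 𝒢)
  have hFm : Measurable F := by
    have h₁ : Measurable fun z : Vec m × Vec m => u z.1 := hu.comp measurable_fst
    have h₂ : Measurable fun z : Vec m × Vec m => ∫ w, w ∂(𝒢 z.1) := hmean.comp measurable_fst
    exact (((measurable_snd.inner h₁).sub (h₂.inner h₁)).const_mul c).sub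
      (((measurable_snd.inner h₁).pow_const 2).const_mul _)
  have hF₁ : ∀ t ω, ∫⁻ v, ENNReal.ofReal (Real.exp (F (x t ω, v))) ∂(𝒢 (x t ω)) ≤ 1 := by
    intro t ω
    obtain ⟨b, hb, hcb⟩ := hc t ω
    exact lintegral_exp_inner_le_one (u := u (x t ω)) (𝒢 (x t ω)) hb hcb
  clear_value F
  have hsucc : ∀ t ω, Y (t + 1) ω = Y t ω + F (x t ω, g t ω) := by
    intro t ω
    simp only [hY, hF, noiseSum, noiseVar, Finset.sum_range_succ]
    ring
  have hYm : ∀ t, Measurable[ℱ t] (Y t) := by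
    intro t
    induction t with
    | zero => simp [hY, noiseSum, noiseVar]
    | succ t ih =>
      rw [show Y (t + 1) = fun ω => Y t ω + F (x t ω, g t ω) from funext (hsucc t)]
      exact (ih.mono (ℱ.mono t.le_succ) le_rfl).add (hFm.comp
        (((hx t).mono (ℱ.mono t.le_succ) le_rfl).prodMk (h.measurable_answer t)))
  have hville := mul_measure_exists_le_of_supermartingale (P := P) (ℱ := ℱ)
    (M := fun t ω => ENNReal.ofReal (Real.exp (Y t ω)))
    (fun t => ENNReal.measurable_ofReal.comp (Real.measurable_exp.comp (hYm t)))
    (fun t A hA => by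
      simp only [hsucc, Real.exp_add, ENNReal.ofReal_mul (Real.exp_pos _).le]
      refine h.setLIntegral_mul_le (hx t)
        (ENNReal.measurable_ofReal.comp (Real.measurable_exp.comp (hYm t)))
        (Φ := fun z => ENNReal.ofReal (Real.exp (F z))) (by fun_prop) (hF₁ t) hA)
    (ENNReal.ofReal (1 / ε)) (T + 1)
  have hset : {ω | ∃ t < T + 1, ENNReal.ofReal (1 / ε) ≤ ENNReal.ofReal (Real.exp (Y t ω))}
      = {ω | ∃ t ≤ T, Real.log (1 / ε) ≤ Y t ω} := by
    ext ω
    simp only [Set.mem_ofPred_eq, Nat.lt_succ_iff]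
    refine exists_congr fun t => and_congr_right fun _ => ?_
    rw [ENNReal.ofReal_le_ofReal_iff (Real.exp_pos _).le, Real.log_le_iff_le_exp (by positivity)]
  rw [hset] at hville
  have h₀ : ∫⁻ ω, ENNReal.ofReal (Real.exp (Y 0 ω)) ∂P = 1 := by
    simp [hY, noiseSum, noiseVar]
  rw [h₀] at hville
  have hreal := ENNReal.toReal_mono ENNReal.one_ne_top hville
  rw [ENNReal.toReal_mul, ENNReal.toReal_ofReal (by positivity), ENNReal.toReal_one,
    mul_comm, mul_one_div, div_le_one hε] at hreal
  exact hreal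

theorem sum_one_div_succ_mul_le (n : ℕ) :
    ∑ i ∈ Finset.range n, 1 / (((i : ℝ) + 1) * (i + 2)) ≤ 1 := by
  suffices h : ∑ i ∈ Finset.range n, 1 / (((i : ℝ) + 1) * (i + 2)) = 1 - 1 / (n + 1) by
    rw [h]
    have : (0 : ℝ) ≤ 1 / (n + 1) := by positivity
    linarith
  induction n with
  | zero => simp
  | succ n ih =>
    rw [Finset.sum_range_succ, ih]
    push_cast
    field_simp
    ring

/-- A time-uniform bound on the noise by its uncentred squares, with iterated-logarithm
dependence on the time. -/
theorem IsDoGRun.measureReal_exists_noise_gt_le (h : IsDoGRun P ℱ X 𝒢 x₀ rε x g)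
    (hx : ∀ t, Measurable[ℱ t] (x t)) (hu : Measurable u) {B δ : ℝ} (hB : 0 < B) (hδ : 0 < δ)
    (hδ₁ : δ < 1)
    (hb : ∀ t ω, ∃ b, (∀ᵐ v ∂(𝒢 (x t ω)), ‖v‖ ≤ b) ∧ b * ‖u (x t ω)‖ ≤ B) (T : ℕ) :
    P.real {ω | ∃ t, 1 ≤ t ∧ t ≤ T ∧
      noiseVar u (fun k => x k ω) (fun k => g k ω) t ≤ t * B ^ 2 ∧
      9 * √(theta t δ * noiseVar u (fun k => x k ω) (fun k => g k ω) t) + 5 * B * theta t δ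
        < |noiseSum 𝒢 u (fun k => x k ω) (fun k => g k ω) t|} ≤ δ := by
  set S : ℕ → Ω → ℝ := fun t ω => noiseSum 𝒢 u (fun k => x k ω) (fun k => g k ω) t
  set V : ℕ → Ω → ℝ := fun t ω => noiseVar u (fun k => x k ω) (fun k => g k ω) t
  -- Scale `i` is tuned to `V` of order `4^i B²`. The `2` in the budget `ε i` pays for both signs,
  -- and the rest telescopes to at most `δ`.
  set c : ℕ → ℝ := fun i => 1 / (2 * B * 2 ^ i) with hcdef
  set ε : ℕ → ℝ := fun i => δ / (2 * ((i + 1) * (i + 2))) with hεdef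
  have hcpos : ∀ i, 0 < c i := fun i => by positivity
  have hεpos : ∀ i, 0 < ε i := fun i => by positivity
  have hcB : ∀ i, c i * B ≤ 1 / 2 := fun i => by
    have h₁ : (1 : ℝ) ≤ 2 ^ i := one_le_pow₀ (by norm_num)
    rw [hcdef, show 1 / (2 * B * 2 ^ i) * B = 1 / (2 * 2 ^ i) by field_simp]
    exact one_div_le_one_div_of_le (by norm_num) (by linarith)
  let bad : ℝ → ℕ → Set Ω := fun s i => {ω | ∃ t ≤ T, Real.log (1 / ε i) ≤
      (s * c i) * S t ω - 2 * (s * c i) ^ 2 * V t ω}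
  have hbad : ∀ s, |s| = 1 → ∀ i, P.real (bad s i) ≤ ε i := fun s hs i =>
    h.measureReal_exists_noise_ge_le hx hu (hεpos i) (fun t ω => by
      obtain ⟨b, hb₁, hb₂⟩ := hb t ω
      refine ⟨b, hb₁, ?_⟩
      rw [abs_mul, hs, one_mul, abs_of_pos (hcpos i)]
      exact (mul_le_mul_of_nonneg_left hb₂ (hcpos i).le).trans (hcB i)) T
  have hsub : {ω | ∃ t, 1 ≤ t ∧ t ≤ T ∧ V t ω ≤ t * B ^ 2 ∧
      9 * √(theta t δ * V t ω) + 5 * B * theta t δ < |S t ω|} ⊆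
      ⋃ i ∈ Finset.range (T + 1), (bad 1 i ∪ bad (-1) i) := by
    rintro ω ⟨t, ht, htT, hV, hlt⟩
    by_contra hω
    simp only [Set.mem_iUnion, Finset.mem_range, Nat.lt_succ_iff, exists_prop, not_exists,
      not_and, Set.mem_union, not_or] at hω
    refine hlt.not_ge (abs_le_of_forall_scale (T := T) hB hδ hδ₁ ht htT
      (Finset.sum_nonneg fun _ _ => sq_nonneg _) hV fun i hi => ?_)
    obtain ⟨h₁, h₂⟩ := hω i hi
    have h₁' : c i * S t ω - 2 * c i ^ 2 * V t ω ≤ Real.log (1 / ε i) := by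
      by_contra! hh
      exact h₁ ⟨t, htT, by rw [one_mul]; exact hh.le⟩
    have h₂' : -(c i * S t ω) - 2 * c i ^ 2 * V t ω ≤ Real.log (1 / ε i) := by
      by_contra! hh
      exact h₂ ⟨t, htT, by
        rw [neg_one_mul, neg_mul, neg_sq]
        exact hh.le⟩
    change |S t ω| ≤ 2 * c i * V t ω + Real.log (1 / ε i) / c i
    have hc := hcpos i
    rw [← sub_le_iff_le_add', le_div_iff₀ hc]
    rcases abs_choice (S t ω) with hS | hS <;> rw [hS] <;> nlinarith
  calc _ ≤ P.real (⋃ i ∈ Finset.range (T + 1), (bad 1 i ∪ bad (-1) i)) :=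
        measureReal_mono hsub (measure_ne_top _ _)
    _ ≤ ∑ i ∈ Finset.range (T + 1), P.real (bad 1 i ∪ bad (-1) i) :=
        measureReal_biUnion_finset_le _ _
    _ ≤ ∑ i ∈ Finset.range (T + 1), δ * (1 / (((i : ℝ) + 1) * (i + 2))) := by
        refine Finset.sum_le_sum fun i _ => ?_
        have h₁ := hbad 1 (by simp) i
        have h₂ := hbad (-1) (by simp) i
        refine (measureReal_union_le _ _).trans ((add_le_add h₁ h₂).trans_eq ?_)
        simp only [hεdef]
        field_simp
        ring
    _ ≤ δ := by
        rw [← Finset.mul_sum]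
        exact mul_le_of_le_one_right hδ.le (sum_one_div_succ_mul_le _)

end Concentration

/-! ### Assembling the bound -/

section Pathwise

variable {m : ℕ} {X : Set (Vec m)} {f : Vec m → ℝ} {xstar : Vec m} {rε D : ℝ} {x g : ℕ → Vec m}

theorem ratioSum_eq_div (t : ℕ) :
    ratioSum rε x t = (∑ k ∈ Finset.range t, rbar rε x k) / rbar rε x t :=
  (Finset.sum_div _ _ _).symm

theorem IsBestTime.one_le {T τ : ℕ} (h : IsBestTime rε x T τ) (hrε : 0 < rε) (hT : 1 ≤ T) :
    1 ≤ τ := by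
  by_contra! hτ
  have h₁ := h.2 1 hT
  rw [Nat.lt_one_iff.1 hτ, ratioSum, ratioSum, Finset.sum_range_one, Finset.sum_range_zero] at h₁
  exact h₁.not_gt (div_pos (rbar_pos hrε) (rbar_pos hrε))

/-- Maximality of `τ` bounds every ratio up to `T` by the one at `τ`, so the growth lemma applies
with that value as `M`. -/
theorem IsBestTime.le_ratioSum {T τ : ℕ} (h : IsBestTime rε x T τ) (hrε : 0 < rε) (hT : 1 ≤ T)
    (hx0 : x 0 ∈ X) (hstep : IsProj X (x 0 - stepSize rε x g 0 • g 0) (x 1))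
    (hD : rbar rε x T ≤ D) : (T : ℝ) ≤ 6 * ratioSum rε x τ * logPlus (D / rε) := by
  have h₁ := le_mul_one_add_log_of_sum_div_le (s := rbar rε x) rbar_mono
    (fun _ => rbar_pos hrε) (rbar_one_le hrε hx0 hstep) hT h.2
  refine h₁.trans ?_
  rw [rbar_zero hrε, logPlus]
  have h₂ : 0 ≤ ratioSum rε x τ :=
    Finset.sum_nonneg fun _ _ => div_nonneg (rbar_pos hrε).le (rbar_pos hrε).le
  have h₃ := rbar_pos (x := x) (t := T) hrε
  gcongr

/-- The suboptimality of the averaged iterate when the unweighted noise stays below `E`. -/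
theorem sum_rbar_mul_suboptimality_le (hf : ConvexOn ℝ X f) (hstar : xstar ∈ X) (hrε : 0 < rε)
    {t : ℕ} {n : ℕ → Vec m} {E : ℝ} (hx : ∀ k, x k ∈ X) (hn : ∀ k, n k ∈ subdiff X f (x k))
    (hstep : ∀ k, IsProj X (x k - stepSize rε x g k • g k) (x (k + 1)))
    (hD : rbar rε x (t + 1) ≤ D) (hd : ‖x 0 - xstar‖ ≤ D)
    (hE : ∀ i ≤ t + 1, |∑ k ∈ Finset.range i,
      (inner ℝ (g k) (x k - xstar) - inner ℝ (n k) (x k - xstar))| ≤ E) :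
    (∑ k ∈ Finset.range (t + 1), rbar rε x k) * (f (xbar rε x (t + 1)) - f xstar) ≤
      rbar rε x (t + 1) * (5 * D * √(gradSum g t) + 2 * E) := by
  have h₁ := sum_rbar_mul_sub_le hf hrε hx hn hstar t.succ_pos
  have h₂ := sum_rbar_mul_inner_le hf.1 hstar hrε hstep hD hd
  set S : ℕ → ℝ := fun i => ∑ k ∈ Finset.range i,
      (inner ℝ (g k) (x k - xstar) - inner ℝ (n k) (x k - xstar)) with hS
  -- Summation by parts removes the random weights, so concentration is needed only for unweighted
  -- noise.
  have h₃ := sum_mul_sub_succ_le (a := rbar rε x) (e := S) (E := E) rbar_mono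
    (rbar_pos hrε).le t fun k hk => (le_abs_self _).trans (hE k (by omega))
  have hE' := hE (t + 1) le_rfl
  have h₄ : rbar rε x t * (E - S (t + 1)) ≤ rbar rε x (t + 1) * (2 * E) := by
    have a₁ : rbar rε x t ≤ rbar rε x (t + 1) := rbar_mono t.le_succ
    have a₂ := rbar_pos (x := x) (t := t) hrε
    have a₃ := neg_le_of_abs_le hE'
    have a₄ : (0 : ℝ) ≤ E := (abs_nonneg _).trans hE'
    exact mul_le_mul a₁ (by linarith) (by linarith [le_of_abs_le hE']) (a₂.le.trans a₁)
  have h₅ : ∑ k ∈ Finset.range (t + 1), rbar rε x k * (S k - S (k + 1)) =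
      ∑ k ∈ Finset.range (t + 1), rbar rε x k * inner ℝ (n k) (x k - xstar)
        - ∑ k ∈ Finset.range (t + 1), rbar rε x k * inner ℝ (g k) (x k - xstar) := by
    rw [← Finset.sum_sub_distrib]
    refine Finset.sum_congr rfl fun k _ => ?_
    simp only [hS, Finset.sum_range_succ]
    ring
  linarith

theorem gradSum_le_mul_sq {L : ℝ} {t : ℕ} (h : ∀ k ≤ t, ‖g k‖ ≤ L) :
    gradSum g t ≤ (t + 1) * L ^ 2 := by
  have := Finset.sum_le_card_nsmul (Finset.range (t + 1)) (fun k => ‖g k‖ ^ 2) (L ^ 2)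
    fun k hk => pow_le_pow_left₀ (norm_nonneg _) (h k (by simpa [Nat.lt_succ_iff] using hk)) 2
  simpa [gradSum] using this

end Pathwise

/-! ### Noise along a run and the final rate. -/

section Main

variable {m : ℕ} {X : Set (Vec m)} {f : Vec m → ℝ} {xstar : Vec m} {𝒢 : Kernel (Vec m) (Vec m)}
  {ℓ : Vec m → ℝ} {Ω : Type*} {mΩ : MeasurableSpace Ω} {P : Measure Ω}
  {ℱ : Filtration ℕ mΩ} {x₀ : Vec m} {rε : ℝ} {x g : ℕ → Ω → Vec m}
  {D δ : ℝ}

theorem IsGradientOracle.ae_norm_le_localBound (hG : IsGradientOracle X f 𝒢 ℓ) (hX : IsClosed X)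
    (hx₀ : x₀ ∈ X) (hD : 0 ≤ D) {y : Vec m} (hy : y ∈ X) (hyD : ‖y - x₀‖ ≤ D) :
    ∀ᵐ v ∂(𝒢 y), ‖v‖ ≤ localBound X ℓ x₀ D := by
  filter_upwards [hG.norm_le y hy] with v hv
  exact hv.trans ((isGreatest_localBound hX hG.continuousOn hx₀ hD).2 ⟨y, ⟨hy, hyD⟩, rfl⟩)

theorem IsDoGRun.ae_norm_answer_le_localBound (h : IsDoGRun P ℱ X 𝒢 x₀ rε x g)
    (hf : ConvexProblem X f xstar) (hG : IsGradientOracle X f 𝒢 ℓ) (hx₀ : x₀ ∈ X) (hD : 0 ≤ D) :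
    ∀ᵐ ω ∂P, ∀ k, ‖x k ω - x₀‖ ≤ D → ‖g k ω‖ ≤ localBound X ℓ x₀ D :=
  ae_all_iff.2 fun k => h.ae_norm_answer_le
    (h.measurable hf.convexOn.1 hf.isClosed hx₀ k) fun ω hω =>
      hG.ae_norm_le_localBound hf.isClosed hx₀ hD (h.mem hx₀ k ω) hω

variable [IsMarkovKernel 𝒢]

theorem IsGradientOracle.localBound_nonneg (hG : IsGradientOracle X f 𝒢 ℓ) (hX : IsClosed X)
    (hx₀ : x₀ ∈ X) (hD : 0 ≤ D) : 0 ≤ localBound X ℓ x₀ D := by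
  obtain ⟨v, hv⟩ := (hG.ae_norm_le_localBound hX hx₀ hD hx₀ (by simpa using hD)).exists
  exact (norm_nonneg v).trans hv

variable [IsProbabilityMeasure P]

/-- With probability at least `1 - δ`, the noise in the inner products with `x_k - x_⋆` is small
at all times up to `T`, on the event that the iterates stay within distance `D`. -/
theorem IsDoGRun.measureReal_noise_gt_le (h : IsDoGRun P ℱ X 𝒢 x₀ rε x g)
    (hf : ConvexProblem X f xstar) (hG : IsGradientOracle X f 𝒢 ℓ) (hx₀ : x₀ ∈ X) (hD : 0 < D)
    (hd : ‖x₀ - xstar‖ ≤ D) (hδ : 0 < δ) (hδ₁ : δ < 1) (T : ℕ) :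
    P.real {ω | rbar rε (fun k => x k ω) T ≤ D ∧ ∃ t < T,
      18 * D * √(theta (t + 1) δ * gradSum (fun k => g k ω) t)
        + 10 * D * localBound X ℓ x₀ D * theta (t + 1) δ <
      |∑ k ∈ Finset.range (t + 1), (inner ℝ (g k ω) (x k ω - xstar)
        - inner ℝ (∫ w, w ∂(𝒢 (x k ω))) (x k ω - xstar))|} ≤ δ := by
  set L := localBound X ℓ x₀ D with hL
  have hL₀ : 0 ≤ L := hG.localBound_nonneg hf.isClosed hx₀ hD.le
  have hnear : ∀ ω, rbar rε (fun k => x k ω) T ≤ D → ∀ k ≤ T, ‖x k ω - x₀‖ ≤ D := by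
    intro ω hω k hk
    have := (norm_sub_le_rbar (rε := rε) (x := fun k => x k ω) hk).trans hω
    rwa [h.init] at this
  have hdist : ∀ y, ‖y - x₀‖ ≤ D → ‖y - xstar‖ ≤ 2 * D := fun y hy => by
    linarith [norm_sub_le_norm_sub_add_norm_sub y x₀ xstar]
  have hae := h.ae_norm_answer_le_localBound hf hG hx₀ hD.le
  -- Concentration needs a positive `B`; when `L = 0` the noise vanishes almost surely on the event
  -- considered.
  rcases hL₀.eq_or_lt with hL0 | hLpos
  · refine le_trans (le_of_eq ?_) hδ.le
    rw [measureReal_eq_zero_iff (measure_ne_top _ _)]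
    refine measure_mono_null (fun ω hω => ?_) (ae_iff.1 hae)
    rintro hg
    obtain ⟨hr, t, ht, hlt⟩ := hω
    refine hlt.not_ge ?_
    have hzero : ∑ k ∈ Finset.range (t + 1), (inner ℝ (g k ω) (x k ω - xstar)
        - inner ℝ (∫ w, w ∂(𝒢 (x k ω))) (x k ω - xstar)) = 0 := by
      refine Finset.sum_eq_zero fun k hk => ?_
      have hk' := hnear ω hr k (by simp at hk; omega)
      have h₁ : g k ω = 0 := norm_le_zero_iff.1 (by simpa [← hL, ← hL0] using hg k hk')
      have h₂ : ∫ w, w ∂(𝒢 (x k ω)) = 0 := by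
        rw [← norm_le_zero_iff]
        refine (norm_integral_le_of_norm_le_const
          (hG.ae_norm_le_localBound hf.isClosed hx₀ hD.le (h.mem hx₀ k ω) hk')).trans ?_
        simp [← hL, ← hL0]
      rw [h₁, h₂, sub_self]
    rw [hzero, abs_zero, ← hL0, mul_zero, zero_mul, add_zero]
    positivity
  · classical
    -- Truncating the direction outside the ball bounds the increments on every path, and changes
    -- nothing up to time `T` when `r̄_T ≤ D`.
    set u : Vec m → Vec m := fun y => if ‖y - x₀‖ ≤ D then y - xstar else 0 with hu
    have hum : Measurable u :=
      Measurable.ite (measurableSet_le (by fun_prop) measurable_const) (by fun_prop)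
        measurable_const
    have key := h.measureReal_exists_noise_gt_le
      (fun t => h.measurable hf.convexOn.1 hf.isClosed hx₀ t) hum
      (B := L * (2 * D)) (by positivity) hδ hδ₁ (fun t ω => by
        by_cases hc : ‖x t ω - x₀‖ ≤ D
        · refine ⟨L, hG.ae_norm_le_localBound hf.isClosed hx₀ hD.le (h.mem hx₀ t ω) hc, ?_⟩
          simp only [hu, if_pos hc]
          exact mul_le_mul_of_nonneg_left (hdist _ hc) hL₀
        · refine ⟨ℓ (x t ω), hG.norm_le _ (h.mem hx₀ t ω), ?_⟩
          simp only [hu, if_neg hc, norm_zero, mul_zero]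
          positivity) T
    refine le_trans ?_ key
    refine ENNReal.toReal_mono (measure_ne_top _ _) (measure_mono_ae ?_)
    filter_upwards [hae] with ω hg
    rintro ⟨hr, t, ht, hlt⟩
    have huk : ∀ k ∈ Finset.range (t + 1), u (x k ω) = x k ω - xstar := fun k hk =>
      if_pos (hnear ω hr k (by simp at hk; omega))
    have hin : ∀ k ∈ Finset.range (t + 1),
        inner ℝ (g k ω) (u (x k ω)) ^ 2 ≤ (2 * D) ^ 2 * ‖g k ω‖ ^ 2 := by
      intro k hk
      rw [huk k hk, ← mul_pow, ← sq_abs]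
      have h₁ := hdist _ (hnear ω hr k (by simp at hk; omega))
      refine pow_le_pow_left₀ (abs_nonneg _) ((abs_real_inner_le_norm _ _).trans ?_) 2
      rw [mul_comm]
      gcongr
    have hVG : noiseVar u (fun k => x k ω) (fun k => g k ω) (t + 1)
        ≤ (2 * D) ^ 2 * gradSum (fun k => g k ω) t := by
      rw [gradSum, Finset.mul_sum]
      exact Finset.sum_le_sum hin
    have hGL := gradSum_le_mul_sq (g := fun k => g k ω) (L := L) (t := t) fun k hk =>
      hg k (hnear ω hr k (by omega))
    refine ⟨t + 1, by omega, ht, ?_, ?_⟩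
    · refine hVG.trans ((mul_le_mul_of_nonneg_left hGL (by positivity)).trans_eq ?_)
      push_cast
      ring
    · have hS : noiseSum 𝒢 u (fun k => x k ω) (fun k => g k ω) (t + 1) =
          ∑ k ∈ Finset.range (t + 1), (inner ℝ (g k ω) (x k ω - xstar)
            - inner ℝ (∫ w, w ∂(𝒢 (x k ω))) (x k ω - xstar)) :=
        Finset.sum_congr rfl fun k hk => by rw [huk k hk]
      rw [hS]
      refine lt_of_le_of_lt ?_ hlt
      have hθ := one_le_theta (t := t + 1) (by omega) hδ hδ₁
      have hsq : √(theta (t + 1) δ * noiseVar u (fun k => x k ω) (fun k => g k ω) (t + 1))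
          ≤ 2 * D * √(theta (t + 1) δ * gradSum (fun k => g k ω) t) := by
        rw [← Real.sqrt_sq (show 0 ≤ 2 * D by positivity), ← Real.sqrt_mul (sq_nonneg _)]
        refine Real.sqrt_le_sqrt ?_
        nlinarith
      linarith

/-- The constants: noise at most `(18 + 10) D R`, regret at most `5 D R`, so `5 + 2 * 28 = 61`; the
ratio bound multiplies by `6`. The second inequality doubles this, by `R ≤ 2 L θ √T`. -/
theorem suboptimality_le_of_noise_le {x g n : ℕ → Vec m} {L : ℝ} {T τ : ℕ}
    (hf : ConvexOn ℝ X f) (hstar : xstar ∈ X) (hrε : 0 < rε) (hx : ∀ k, x k ∈ X)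
    (hn : ∀ k, n k ∈ subdiff X f (x k))
    (hstep : ∀ k, IsProj X (x k - stepSize rε x g k • g k) (x (k + 1)))
    (hD : rbar rε x T ≤ D) (hd : ‖x 0 - xstar‖ ≤ D) (hL : 0 ≤ L) (hδ : 0 < δ) (hδ₁ : δ < 1)
    (hT : 1 ≤ T) (hτ : IsBestTime rε x T τ) (hg : ∀ k < T, ‖g k‖ ≤ L)
    (hnoise : ∀ t < T, |∑ k ∈ Finset.range (t + 1),
      (inner ℝ (g k) (x k - xstar) - inner ℝ (n k) (x k - xstar))| ≤
        18 * D * √(theta (t + 1) δ * gradSum g t) + 10 * D * L * theta (t + 1) δ) :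
    f (xbar rε x τ) - f xstar ≤
        366 * (D * √(gradSum g (τ - 1) * theta τ δ + L ^ 2 * theta τ δ ^ 2) / T
          * logPlus (D / rε)) ∧
      366 * (D * √(gradSum g (τ - 1) * theta τ δ + L ^ 2 * theta τ δ ^ 2) / T
          * logPlus (D / rε)) ≤
        732 * (D * L / √T * theta τ δ * logPlus (D / rε)) := by
  have hτ₁ := hτ.one_le hrε hT
  have hratio := hτ.le_ratioSum hrε hT (hx 0) (hstep 0) hD
  obtain ⟨t, rfl⟩ : ∃ t, τ = t + 1 := ⟨τ - 1, by omega⟩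
  have htT : t < T := hτ.1
  have hDpos : 0 < D := (rbar_pos hrε).trans_le hD
  have hTpos : (0 : ℝ) < T := by exact_mod_cast hT
  have hlog : 1 ≤ logPlus (D / rε) := by
    have : 1 ≤ D / rε := (one_le_div hrε).2 (le_rbar.trans hD)
    rw [logPlus]
    linarith [Real.log_nonneg this]
  have hθ : 1 ≤ theta (t + 1) δ := one_le_theta hτ₁ hδ hδ₁
  rw [Nat.add_sub_cancel]
  set θ := theta (t + 1) δ
  set G := gradSum g t with hGdef
  have hG : 0 ≤ G := gradSum_nonneg
  set R := √(G * θ + L ^ 2 * θ ^ 2) with hR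
  have hR₀ : 0 ≤ R := Real.sqrt_nonneg _
  have hθG : √(θ * G) ≤ R := Real.sqrt_le_sqrt (by nlinarith [sq_nonneg (L * θ)])
  have hGR : √G ≤ R := (Real.sqrt_le_sqrt (by nlinarith)).trans hθG
  have hLR : L * θ ≤ R := Real.le_sqrt_of_sq_le (by nlinarith)
  constructor
  · have hE : ∀ i ≤ t + 1, |∑ k ∈ Finset.range i,
        (inner ℝ (g k) (x k - xstar) - inner ℝ (n k) (x k - xstar))| ≤ 28 * D * R := by
      intro i hi
      cases i with
      | zero =>
        simp only [Finset.range_zero, Finset.sum_empty, abs_zero]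
        positivity
      | succ i =>
        refine (hnoise i (by omega)).trans ?_
        have h₁ : theta (i + 1) δ ≤ θ := theta_mono (by omega) hi hδ
        have h₂ : gradSum g i ≤ G := gradSum_mono (by omega)
        have h₃ : 1 ≤ theta (i + 1) δ := one_le_theta (by omega) hδ hδ₁
        have h₄ : √(theta (i + 1) δ * gradSum g i) ≤ R :=
          (Real.sqrt_le_sqrt (mul_le_mul h₁ h₂ gradSum_nonneg (by linarith))).trans hθG
        have h₅ : L * theta (i + 1) δ ≤ R := (mul_le_mul_of_nonneg_left h₁ hL).trans hLR
        have h₆ := mul_le_mul_of_nonneg_left h₄ hDpos.le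
        have h₇ := mul_le_mul_of_nonneg_left h₅ hDpos.le
        linarith
    have hmain := sum_rbar_mul_suboptimality_le hf hstar hrε hx hn hstep
      ((rbar_mono hτ.1).trans hD) hd hE
    set Δ := f (xbar rε x (t + 1)) - f xstar
    have hr := rbar_pos (x := x) (t := t + 1) hrε
    have hle : ratioSum rε x (t + 1) * Δ ≤ 61 * D * R := by
      rw [ratioSum_eq_div, div_mul_eq_mul_div, div_le_iff₀ hr, mul_comm _ (rbar rε x (t + 1))]
      refine hmain.trans (mul_le_mul_of_nonneg_left ?_ hr.le)
      have := mul_le_mul_of_nonneg_left hGR hDpos.le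
      linarith
    rcases le_total Δ 0 with hΔ | hΔ
    · exact hΔ.trans (by positivity)
    · rw [div_mul_eq_mul_div, ← mul_div_assoc, le_div_iff₀ hTpos]
      calc Δ * T ≤ Δ * (6 * ratioSum rε x (t + 1) * logPlus (D / rε)) := by gcongr
        _ = 6 * logPlus (D / rε) * (ratioSum rε x (t + 1) * Δ) := by ring
        _ ≤ 6 * logPlus (D / rε) * (61 * D * R) := by gcongr
        _ = 366 * (D * R * logPlus (D / rε)) := by ring
  · have hGL : G ≤ T * L ^ 2 := by
      refine (gradSum_le_mul_sq fun k hk => hg k (by omega)).trans ?_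
      gcongr
      exact_mod_cast htT
    have hsT : 0 < √(T : ℝ) := Real.sqrt_pos.2 hTpos
    have hsT2 : √(T : ℝ) ^ 2 = T := Real.sq_sqrt hTpos.le
    have hRle : R ≤ 2 * (L * θ * √T) := by
      refine Real.sqrt_le_iff.2 ⟨by positivity, ?_⟩
      have hT₁ : (1 : ℝ) ≤ T := by exact_mod_cast hT
      have h₁ : G * θ ≤ T * L ^ 2 * θ ^ 2 := by
        refine mul_le_mul hGL (by nlinarith) (by linarith) (by positivity)
      have h₂ : L ^ 2 * θ ^ 2 ≤ T * (L ^ 2 * θ ^ 2) := le_mul_of_one_le_left (by positivity) hT₁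
      have h₃ : (2 * (L * θ * √T)) ^ 2 = 4 * (T * (L ^ 2 * θ ^ 2)) := by
        rw [mul_pow, mul_pow, mul_pow, hsT2]
        ring
      nlinarith
    calc 366 * (D * R / T * logPlus (D / rε))
        ≤ 366 * (D * (2 * (L * θ * √T)) / T * logPlus (D / rε)) := by gcongr
      _ = 732 * (D * L * θ * (√T / T) * logPlus (D / rε)) := by ring
      _ = _ := by
        rw [Real.sqrt_div_self', one_div]
        ring

end Main

end DoG

theorem mainTheorem4 :
    ∃ C₁ C₂ : ℝ, 0 < C₁ ∧ 0 < C₂ ∧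
      ∀ (m : ℕ) (X : Set (DoG.Vec m)) (f : DoG.Vec m → ℝ) (xstar : DoG.Vec m)
        (𝒢 : ProbabilityTheory.Kernel (DoG.Vec m) (DoG.Vec m))
        [ProbabilityTheory.IsMarkovKernel 𝒢] (ℓ : DoG.Vec m → ℝ)
        (Ω : Type*) [mΩ : MeasurableSpace Ω] (P : MeasureTheory.Measure Ω)
        [MeasureTheory.IsProbabilityMeasure P] (ℱ : MeasureTheory.Filtration ℕ mΩ)
        (x₀ : DoG.Vec m) (rε : ℝ) (x g : ℕ → Ω → DoG.Vec m) (D δ : ℝ) (T : ℕ),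
        DoG.ConvexProblem X f xstar →
        DoG.IsGradientOracle X f 𝒢 ℓ →
        x₀ ∈ X → 0 < rε →
        DoG.IsDoGRun P ℱ X 𝒢 x₀ rε x g →
        ‖x₀ - xstar‖ ≤ D → 0 < δ → δ < 1 → 1 ≤ T →
        1 - δ - P.real {ω | D < DoG.rbar rε (fun k => x k ω) T} ≤
          P.real {ω | ∀ τ : ℕ, DoG.IsBestTime rε (fun k => x k ω) T τ →
            f (DoG.xbar rε (fun k => x k ω) τ) - f xstar ≤
                C₁ * (D * √(DoG.gradSum (fun k => g k ω) (τ - 1) * DoG.theta τ δ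
                  + DoG.localBound X ℓ x₀ D ^ 2 * DoG.theta τ δ ^ 2) / T
                  * DoG.logPlus (D / rε)) ∧
              C₁ * (D * √(DoG.gradSum (fun k => g k ω) (τ - 1) * DoG.theta τ δ
                  + DoG.localBound X ℓ x₀ D ^ 2 * DoG.theta τ δ ^ 2) / T
                  * DoG.logPlus (D / rε)) ≤
                C₂ * (D * DoG.localBound X ℓ x₀ D / √T * DoG.theta τ δ
                  * DoG.logPlus (D / rε))} := by
  refine ⟨366, 732, by norm_num, by norm_num, ?_⟩
  intro m X f xstar 𝒢 _ ℓ Ω mΩ P _ ℱ x₀ rε x g D δ T hf hG hx₀ hrε h hd hδ hδ₁ hT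
  have hD : 0 ≤ D := (norm_nonneg _).trans hd
  have hmin : ∀ ω, rε ≤ DoG.rbar rε (fun k => x k ω) T := fun ω => DoG.le_rbar
  set good := {ω | ∀ τ : ℕ, DoG.IsBestTime rε (fun k => x k ω) T τ →
            f (DoG.xbar rε (fun k => x k ω) τ) - f xstar ≤
                366 * (D * √(DoG.gradSum (fun k => g k ω) (τ - 1) * DoG.theta τ δ
                  + DoG.localBound X ℓ x₀ D ^ 2 * DoG.theta τ δ ^ 2) / T
                  * DoG.logPlus (D / rε)) ∧
              366 * (D * √(DoG.gradSum (fun k => g k ω) (τ - 1) * DoG.theta τ δ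
                  + DoG.localBound X ℓ x₀ D ^ 2 * DoG.theta τ δ ^ 2) / T
                  * DoG.logPlus (D / rε)) ≤
                732 * (D * DoG.localBound X ℓ x₀ D / √T * DoG.theta τ δ
                  * DoG.logPlus (D / rε))}
  set far := {ω | D < DoG.rbar rε (fun k => x k ω) T}
  -- If `D = 0`, then `r̄_T ≥ r_ε > D` always, and the probability claimed is negative.
  rcases hD.eq_or_lt with hD0 | hDpos
  · have : far = Set.univ := Set.eq_univ_of_forall fun ω => by
      change D < _
      rw [← hD0]
      exact hrε.trans_le (hmin ω)
    rw [this, probReal_univ]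
    have : 0 ≤ P.real good := measureReal_nonneg
    linarith
  have hnoise := h.measureReal_noise_gt_le hf hG hx₀ hDpos hd hδ hδ₁ T
  set noisy := {ω | DoG.rbar rε (fun k => x k ω) T ≤ D ∧ ∃ t < T,
      18 * D * √(DoG.theta (t + 1) δ * DoG.gradSum (fun k => g k ω) t)
        + 10 * D * DoG.localBound X ℓ x₀ D * DoG.theta (t + 1) δ <
      |∑ k ∈ Finset.range (t + 1), (inner ℝ (g k ω) (x k ω - xstar)
        - inner ℝ (∫ w, w ∂(𝒢 (x k ω))) (x k ω - xstar))|}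
  -- Almost every path lies in the union. Only monotonicity and subadditivity are used, so `good`
  -- need not be measurable.
  have hcover : P.real Set.univ ≤ P.real (good ∪ (noisy ∪ far)) := by
    refine ENNReal.toReal_mono (measure_ne_top _ _) (measure_mono_ae ?_)
    filter_upwards [h.ae_norm_answer_le_localBound hf hG hx₀ hD] with ω hg _
    by_cases hω : D < DoG.rbar rε (fun k => x k ω) T
    · exact Or.inr (Or.inr hω)
    by_cases hω' : ω ∈ noisy
    · exact Or.inr (Or.inl hω')
    refine Or.inl fun τ hτ => ?_
    have hr := not_lt.1 hω
    have hnear : ∀ k ≤ T, ‖x k ω - x₀‖ ≤ D := fun k hk => by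
      have := (DoG.norm_sub_le_rbar (rε := rε) (x := fun k => x k ω) hk).trans hr
      rwa [h.init] at this
    refine DoG.suboptimality_le_of_noise_le hf.convexOn hf.mem hrε (fun k => h.mem hx₀ k ω)
      (n := fun k => ∫ w, w ∂(𝒢 (x k ω))) (fun k => hG.mean_mem _ (h.mem hx₀ k ω))
      (fun k => h.step k ω) hr (by rwa [h.init]) (hG.localBound_nonneg hf.isClosed hx₀ hD)
      hδ hδ₁ hT hτ (fun k hk => hg k (hnear k hk.le)) fun t ht => ?_
    by_contra! hlt
    exact hω' ⟨hr, t, ht, hlt⟩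
  rw [probReal_univ] at hcover
  have h₁ := measureReal_union_le (μ := P) good (noisy ∪ far)
  have h₂ := measureReal_union_le (μ := P) noisy far
  linarith
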